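/- A partition of a set consists of nonempty, pairwise disjoint sets whose union is the whole set. Let $$\mathfrak{sp}(\mathrm{closed}) = \{|\mathcal P| : \mathcal P \text{ is a partition of } \mathbb{R} \text{ into at least two closed sets}\}.$$ Let $\acute{\mathfrak n}$ (the Sierpiński cardinal) be the minimal size of a partition of the Baire space $\omega^\omega$ (with the product topology) into compact sets, and let $\mathfrak d$ (the dominating number) be the least size of a family $D \subseteq \omega^\omega$ such that for every $f \in \omega^\omega$ there is $g \in D$ with $f(n) \le g(n)$ for all but finitely many $n$. Then $\mathfrak{sp}(\mathrm{closed})$ has a least element, and $$\min \mathfrak{sp}(\mathrm{closed}) = \acute{\mathfrak n} \ge \mathfrak d.$$ -/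

import Mathlib

open Cardinal

/-- The closed partition spectrum: the set of all cardinalities of partitions of the real line
into at least two (nonempty, pairwise disjoint) closed sets. -/
def closedPartitionSpectrum : Set Cardinal.{0} :=
  {κ | ∃ P : Set (Set ℝ), Setoid.IsPartition P ∧ (∀ C ∈ P, IsClosed C) ∧ 2 ≤ #P ∧ #P = κ}

/-- The cardinalities of partitions of the Baire space `ℕ → ℕ` (with the product topology)
into nonempty compact sets. -/
def compactPartitionSizes : Set Cardinal.{0} :=
  {κ | ∃ P : Set (Set (ℕ → ℕ)), Setoid.IsPartition P ∧ (∀ K ∈ P, IsCompact K) ∧ #P = κ}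

/-- The Sierpiński cardinal: the minimal size of a partition of the Baire space into
compact sets. -/
noncomputable def sierpinskiCardinal : Cardinal.{0} :=
  sInf compactPartitionSizes

/-- A family of functions `ℕ → ℕ` is dominating if every function `ℕ → ℕ` is eventually
bounded above by a member of the family. -/
def IsDominatingFamily (D : Set (ℕ → ℕ)) : Prop :=
  ∀ f : ℕ → ℕ, ∃ g ∈ D, ∀ᶠ n in Filter.atTop, f n ≤ g n

/-- The sizes of dominating families. -/
def dominatingFamilySizes : Set Cardinal.{0} :=
  {κ | ∃ D : Set (ℕ → ℕ), IsDominatingFamily D ∧ #D = κ}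

/-- The dominating number: the minimal size of a dominating family. -/
noncomputable def dominatingNumber : Cardinal.{0} :=
  sInf dominatingFamilySizes

/-- The infimum defining the Sierpiński cardinal is attained: the Baire space can be
partitioned into singletons. -/
theorem isLeast_sierpinskiCardinal : IsLeast compactPartitionSizes sierpinskiCardinal := by
  refine isLeast_csInf ⟨_, Set.range (fun x : ℕ → ℕ => ({x} : Set (ℕ → ℕ))), ⟨?_, ?_⟩, ?_, rfl⟩
  · rintro ⟨x, hx⟩
    exact Set.singleton_ne_empty x hx
  · intro a
    refine ⟨{a}, ⟨⟨a, rfl⟩, rfl⟩, ?_⟩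
    rintro _ ⟨⟨y, rfl⟩, hy⟩
    rw [Set.mem_singleton_iff.mp hy]
  · rintro _ ⟨x, rfl⟩
    exact isCompact_singleton

/-- The infimum defining the dominating number is attained. -/
theorem isLeast_dominatingNumber : IsLeast dominatingFamilySizes dominatingNumber :=
  isLeast_csInf ⟨_, Set.univ,
    fun f => ⟨f, Set.mem_univ f, Filter.Eventually.of_forall fun _ => le_rfl⟩, rfl⟩

/-! Lower bound: in a closed partition of the line with at least two pieces, let `K` be the union of
the frontiers. By connectedness of intervals, each point of `K` is a limit of points of `K` outside
its own piece. A tree of shrinking balls centred in `K`, whose children accumulate at the parent's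
centre but avoid that centre's piece, defines a continuous map from Baire space. Each piece meets
the tree in a finitely branching subtree, so its preimage is compact, and the preimages partition
Baire space.

Upper bound: a continuous bijection `ℤ × (ℕ → ℕ) → ℝ` carries compact pieces to compact, hence
closed, pieces; the factor `ℵ₀` is absorbed. For the dominating number, each compact piece has a
pointwise upper bound. -/

/-! ### From closed partitions of the line to compact partitions of Baire space -/

theorem exists_isCompact_preimage_of_partition {X : Type*} [MetricSpace X] [ProperSpace X]
    {P : Set (Set X)} (hP : Setoid.IsPartition P) (hcl : ∀ C ∈ P, IsClosed C) {K : Set X}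
    (hne : K.Nonempty) (hK : ∀ C ∈ P, ∀ x ∈ K ∩ C, x ∈ closure (K \ C)) :
    ∃ φ : (ℕ → ℕ) → X, Continuous φ ∧ ∀ C ∈ P, IsCompact (φ ⁻¹' C) := by
  let S := {p : X × ℝ // p.1 ∈ K ∧ 0 < p.2}
  have step : ∀ (s : S) (n : ℕ), ∃ t : S,
      Metric.closedBall t.1.1 t.1.2 ⊆ Metric.closedBall s.1.1 s.1.2 ∧
      Metric.closedBall t.1.1 t.1.2 ⊆ Metric.ball s.1.1 (1 / ((n : ℝ) + 1)) ∧
      t.1.2 ≤ s.1.2 / 2 ∧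
      ∀ C ∈ P, s.1.1 ∈ C → Disjoint (Metric.closedBall t.1.1 t.1.2) C := by
    rintro ⟨⟨x, r⟩, hx, hr⟩ n
    dsimp only at hx hr ⊢
    obtain ⟨C, ⟨hC, hxC⟩, huniq⟩ := hP.2 x
    have hpos : (0 : ℝ) < min r (1 / ((n : ℝ) + 1)) := lt_min hr (by positivity)
    obtain ⟨y, ⟨hyK, hyC⟩, hxy⟩ := Metric.mem_closure_iff.1 (hK C hC x ⟨hx, hxC⟩) _ hpos
    have hopen : IsOpen (Metric.ball x (min r (1 / ((n : ℝ) + 1))) ∩ Cᶜ) :=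
      Metric.isOpen_ball.inter (hcl C hC).isOpen_compl
    have hy : y ∈ Metric.ball x (min r (1 / ((n : ℝ) + 1))) ∩ Cᶜ :=
      ⟨by rwa [Metric.mem_ball, dist_comm], hyC⟩
    obtain ⟨s, hs, hsub⟩ := Metric.nhds_basis_closedBall.mem_iff.1 (hopen.mem_nhds hy)
    have hsub' := (Metric.closedBall_subset_closedBall (x := y) (min_le_left s (r / 2))).trans hsub
    refine ⟨⟨(y, min s (r / 2)), hyK, lt_min hs (half_pos hr)⟩, ?_, ?_, min_le_right _ _, ?_⟩
    · exact fun z hz => Metric.ball_subset_closedBall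
        (Metric.ball_subset_ball (min_le_left _ _) (hsub' hz).1)
    · exact fun z hz => Metric.ball_subset_ball (min_le_right _ _) (hsub' hz).1
    · intro C' hC' hxC'
      rw [huniq C' ⟨hC', hxC'⟩]
      exact Set.disjoint_left.2 fun z hz => (hsub' hz).2
  choose next hnest hnear hhalf hdisj using step
  obtain ⟨x₀, hx₀⟩ := hne
  let s₀ : S := ⟨(x₀, 1), hx₀, one_pos⟩
  let st : (ℕ → ℕ) → ℕ → S := fun f n => Nat.rec s₀ (fun k s => next s (f k)) n
  have st_succ : ∀ f n, st f (n + 1) = next (st f n) (f n) := fun f n => rfl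
  have st_congr : ∀ (f g : ℕ → ℕ) n, (∀ i < n, f i = g i) → st f n = st g n := by
    intro f g n
    induction n with
    | zero => exact fun _ => rfl
    | succ n ih =>
      intro h
      rw [st_succ, st_succ, ih fun i hi => h i (hi.trans n.lt_succ_self), h n n.lt_succ_self]
  have st_rad : ∀ f n, (st f n).1.2 ≤ (1 / 2 : ℝ) ^ n := by
    intro f n
    induction n with
    | zero => simp [st, s₀]
    | succ n ih =>
      rw [st_succ, pow_succ]
      have := hhalf (st f n) (f n)
      linarith
  have hlim : ∀ f, ∃ x, ∀ n, x ∈ Metric.closedBall (st f n).1.1 (st f n).1.2 := by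
    intro f
    obtain ⟨x, hx⟩ := IsCompact.nonempty_iInter_of_sequence_nonempty_isCompact_isClosed
      (fun n => Metric.closedBall (st f n).1.1 (st f n).1.2)
      (fun n => hnest (st f n) (f n))
      (fun n => Metric.nonempty_closedBall.2 (st f n).2.2.le)
      (isCompact_closedBall _ _) (fun n => Metric.isClosed_closedBall)
    exact ⟨x, Set.mem_iInter.1 hx⟩
  choose φ hφ using hlim
  have hφc : Continuous φ := by
    rw [continuous_iff_continuousAt]
    intro f
    rw [ContinuousAt, Metric.tendsto_nhds]
    intro ε hε
    obtain ⟨n, hn⟩ := exists_pow_lt_of_lt_one (half_pos hε) (by norm_num : (1 / 2 : ℝ) < 1)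
    filter_upwards [(PiNat.isOpen_cylinder (fun _ : ℕ => ℕ) f n).mem_nhds
      (PiNat.self_mem_cylinder f n)] with g hg
    have h1 := hφ g n
    rw [st_congr g f n (PiNat.mem_cylinder_iff.1 hg)] at h1
    have h2 := hφ f n
    have h3 := st_rad f n
    have h4 := dist_triangle_right (φ g) (φ f) (st f n).1.1
    rw [Metric.mem_closedBall] at h1 h2
    linarith
  refine ⟨φ, hφc, fun C hC => ?_⟩
  -- If infinitely many children of `s` meet the closed set `C`, then the centre of `s`, being their
  -- limit, lies in `C`; but then every child avoids `C`.
  have hbranch : ∀ n (s : S), {m | ∃ f ∈ φ ⁻¹' C, st f n = s ∧ f n = m}.Finite := by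
    intro n s
    by_contra hinf
    have hinf : Set.Infinite _ := hinf
    have hsC : s.1.1 ∈ C := by
      rw [← (hcl C hC).closure_eq, Metric.mem_closure_iff]
      intro ε hε
      obtain ⟨N, hN⟩ := exists_nat_one_div_lt hε
      obtain ⟨m, ⟨f, hf, rfl, rfl⟩, hm⟩ := hinf.exists_gt N
      refine ⟨φ f, hf, ?_⟩
      have h1 := hnear _ _ (hφ f (n + 1))
      rw [Metric.mem_ball, dist_comm] at h1
      refine h1.trans (lt_of_le_of_lt ?_ hN)
      have : (N : ℝ) ≤ f n := by exact_mod_cast hm.le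
      gcongr
    obtain ⟨m, f, hf, rfl, rfl⟩ := hinf.nonempty
    exact Set.disjoint_left.1 (hdisj _ (f n) C hC hsC) (hφ f (n + 1)) hf
  have hpairs : ∀ n, ((fun f => st f n) '' (φ ⁻¹' C)).Finite →
      ((fun f => (st f n, f n)) '' (φ ⁻¹' C)).Finite := by
    intro n hn
    refine (hn.biUnion fun s _ => (Set.finite_singleton s).prod (hbranch n s)).subset ?_
    rintro _ ⟨f, hf, rfl⟩
    exact Set.mem_biUnion (Set.mem_image_of_mem _ hf) ⟨rfl, f, hf, rfl, rfl⟩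
  have hstates : ∀ n, ((fun f => st f n) '' (φ ⁻¹' C)).Finite := by
    intro n
    induction n with
    | zero => exact (Set.finite_singleton s₀).subset (by rintro _ ⟨f, -, rfl⟩; rfl)
    | succ n ih =>
      refine ((hpairs n ih).image fun p => next p.1 p.2).subset ?_
      rintro _ ⟨f, hf, rfl⟩
      exact ⟨_, Set.mem_image_of_mem _ hf, rfl⟩
  have hbox : IsCompact (Set.univ.pi fun n => (fun f : ℕ → ℕ => f n) '' (φ ⁻¹' C)) :=
    isCompact_univ_pi fun n => Set.Finite.isCompact <| by
      have := (hpairs n (hstates n)).image Prod.snd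
      rwa [Set.image_image] at this
  exact hbox.of_isClosed_subset ((hcl C hC).preimage hφc)
    fun f hf n _ => Set.mem_image_of_mem _ hf

theorem sierpinskiCardinal_le_of_isCompact_preimage {X : Type} {P : Set (Set X)}
    (hP : Setoid.IsPartition P) {φ : (ℕ → ℕ) → X} (hφ : ∀ C ∈ P, IsCompact (φ ⁻¹' C)) :
    sierpinskiCardinal ≤ #P := by
  -- `φ` need not be surjective, so empty preimages are discarded.
  have hmem : #(((φ ⁻¹' ·) '' P) \ {∅} : Set (Set (ℕ → ℕ))) ∈ compactPartitionSizes := by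
    refine ⟨_, ⟨fun h => h.2 rfl, fun f => ?_⟩, ?_, rfl⟩
    · obtain ⟨C, ⟨hC, hfC⟩, huniq⟩ := hP.2 (φ f)
      refine ⟨φ ⁻¹' C, ⟨⟨⟨C, hC, rfl⟩, Set.Nonempty.ne_empty ⟨f, hfC⟩⟩, hfC⟩, ?_⟩
      rintro _ ⟨⟨⟨C', hC', rfl⟩, -⟩, hf⟩
      rw [huniq C' ⟨hC', hf⟩]
    · rintro _ ⟨⟨C, hC, rfl⟩, -⟩
      exact hφ C hC
  exact (isLeast_sierpinskiCardinal.2 hmem).trans ((mk_le_mk_of_subset Set.sdiff_subset).trans mk_image_le)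

/-- In a partition of the line into closed sets, every boundary point of a piece is a limit of
boundary points of other pieces. -/
theorem mem_closure_iUnion_frontier_diff {P : Set (Set ℝ)} (hP : Setoid.IsPartition P)
    (hcl : ∀ C ∈ P, IsClosed C) {C : Set ℝ} (hC : C ∈ P) {x : ℝ}
    (hx : x ∈ (⋃ D ∈ P, frontier D) ∩ C) : x ∈ closure ((⋃ D ∈ P, frontier D) \ C) := by
  have eq_of_mem : ∀ D ∈ P, ∀ E ∈ P, ∀ z, z ∈ D → z ∈ E → D = E := fun D hD E hE z hzD hzE =>
    (hP.2 z).unique ⟨hD, hzD⟩ ⟨hE, hzE⟩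
  obtain ⟨hx, hxC⟩ := hx
  obtain ⟨D, hD, hxD⟩ := Set.mem_iUnion₂.1 hx
  obtain rfl := eq_of_mem D hD C hC x ((hcl D hD).frontier_subset hxD) hxC
  rw [Metric.mem_closure_iff]
  intro ε hε
  rw [frontier_eq_closure_inter_closure] at hxD
  obtain ⟨y, hyD, hxy⟩ := Metric.mem_closure_iff.1 hxD.2 ε hε
  obtain ⟨E, ⟨hE, hyE⟩, -⟩ := hP.2 y
  have hxE : x ∉ E := fun h => hyD (eq_of_mem E hE D hD x h hxC ▸ hyE)
  have hconn : IsPreconnected (Metric.ball x ε) := (convex_ball x ε).isPreconnected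
  -- The ball contains `y ∈ E` and `x ∉ E`; without frontier points of `E`, it would be split by two
  -- disjoint open sets.
  obtain ⟨z, hzb, hzE⟩ : (Metric.ball x ε ∩ frontier E).Nonempty := by
    by_contra hempty
    have hint : ∀ z ∈ Metric.ball x ε, z ∈ E → z ∈ interior E := fun z hz hzE => by
      by_contra hzi
      exact hempty ⟨z, hz, subset_closure hzE, hzi⟩
    have hyb : y ∈ Metric.ball x ε := by rwa [Metric.mem_ball, dist_comm]
    obtain ⟨z, -, hzi, hzc⟩ := hconn (interior E) Eᶜ isOpen_interior (hcl E hE).isOpen_compl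
      (fun z hz => (em (z ∈ E)).imp (hint z hz) id) ⟨y, hyb, hint y hyb hyE⟩
      ⟨x, Metric.mem_ball_self hε, hxE⟩
    exact hzc (interior_subset hzi)
  refine ⟨z, ⟨Set.mem_iUnion₂.2 ⟨E, hE, hzE⟩, fun hzD => ?_⟩, by rwa [dist_comm]⟩
  exact hxE (eq_of_mem D hD E hE z hzD ((hcl E hE).frontier_subset hzE) ▸ hxC)

theorem nonempty_iUnion_frontier {P : Set (Set ℝ)} (hP : Setoid.IsPartition P) (h2 : 2 ≤ #P) :
    (⋃ D ∈ P, frontier D).Nonempty := by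
  obtain ⟨⟨C, hC⟩, ⟨D, hD⟩, hCD⟩ := two_le_iff.1 h2
  have hne : ∀ E ∈ P, E.Nonempty := fun E hE => Set.nonempty_iff_ne_empty.2 fun h => hP.1 (h ▸ hE)
  have hCuniv : C ≠ Set.univ := by
    rintro rfl
    obtain ⟨z, hz⟩ := hne D hD
    exact hCD (Subtype.ext ((hP.2 z).unique ⟨hC, Set.mem_univ z⟩ ⟨hD, hz⟩))
  obtain ⟨z, hz⟩ := nonempty_frontier_iff.2 ⟨hne C hC, hCuniv⟩
  exact ⟨z, Set.mem_iUnion₂.2 ⟨C, hC, hz⟩⟩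

theorem sierpinskiCardinal_le_of_isClosed_partition {P : Set (Set ℝ)}
    (hP : Setoid.IsPartition P) (hcl : ∀ C ∈ P, IsClosed C) (h2 : 2 ≤ #P) :
    sierpinskiCardinal ≤ #P := by
  obtain ⟨φ, -, hφ⟩ := exists_isCompact_preimage_of_partition hP hcl
    (nonempty_iUnion_frontier hP h2)
    fun C hC x hx => mem_closure_iUnion_frontier_diff hP hcl hC hx
  exact sierpinskiCardinal_le_of_isCompact_preimage hP hφ

/-! ### Lower bounds for the Sierpiński cardinal -/

theorem aleph0_le_sierpinskiCardinal : ℵ₀ ≤ sierpinskiCardinal := by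
  obtain ⟨P, hP, hK, hcard⟩ := isLeast_sierpinskiCardinal.1
  rw [← hcard, aleph0_le_mk_iff, Set.infinite_coe_iff]
  intro hfin
  have hcpt : IsCompact (Set.univ : Set (ℕ → ℕ)) := by
    rw [← hP.sUnion_eq_univ]
    exact hfin.isCompact_sUnion hK
  have := (hcpt.image (continuous_apply 0)).finite_of_discrete
  rw [Set.image_univ, (Function.surjective_eval 0).range_eq] at this
  exact Set.infinite_univ this

theorem dominatingNumber_le_sierpinskiCardinal : dominatingNumber ≤ sierpinskiCardinal := by
  obtain ⟨P, hP, hK, hcard⟩ := isLeast_sierpinskiCardinal.1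
  have hbound : ∀ K : P, ∃ g : ℕ → ℕ, ∀ f ∈ K.1, ∀ n, f n ≤ g n := by
    intro K
    have h : ∀ n, ∃ b, ∀ f ∈ K.1, f n ≤ b := by
      intro n
      obtain ⟨b, hb⟩ := ((hK K.1 K.2).image (continuous_apply n)).bddAbove
      exact ⟨b, fun f hf => hb (Set.mem_image_of_mem _ hf)⟩
    choose g hg using h
    exact ⟨g, fun f hf n => hg n f hf⟩
  choose g hg using hbound
  have hdom : IsDominatingFamily (Set.range g) := by
    intro f
    obtain ⟨K, ⟨hKP, hfK⟩, -⟩ := hP.2 f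
    exact ⟨_, ⟨⟨K, hKP⟩, rfl⟩, Filter.Eventually.of_forall (hg ⟨K, hKP⟩ f hfK)⟩
  calc dominatingNumber ≤ #(Set.range g) := isLeast_dominatingNumber.2 ⟨_, hdom, rfl⟩
    _ ≤ #P := mk_range_le
    _ = sierpinskiCardinal := hcard

/-! ### A continuous bijection onto the line -/

/-- The real number whose binary expansion consists of the ones separated by `f 0, f 1, …`
zeros. -/
noncomputable def binaryGapSum (f : ℕ → ℕ) : ℝ :=
  ∑' n, (1 / 2 : ℝ) ^ (∑ i ∈ Finset.range (n + 1), (f i + 1))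

theorem binaryGapSum_term_le (f : ℕ → ℕ) (n : ℕ) :
    (1 / 2 : ℝ) ^ (∑ i ∈ Finset.range (n + 1), (f i + 1)) ≤ 1 / 2 * (1 / 2) ^ n := by
  rw [← pow_succ']
  refine pow_le_pow_of_le_one (by norm_num) (by norm_num) ?_
  rw [Finset.sum_add_distrib]
  simp

theorem summable_binaryGapSum (f : ℕ → ℕ) :
    Summable fun n => (1 / 2 : ℝ) ^ (∑ i ∈ Finset.range (n + 1), (f i + 1)) :=
  Summable.of_nonneg_of_le (fun _ => by positivity) (binaryGapSum_term_le f)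
    (summable_geometric_two.mul_left _)

theorem continuous_binaryGapSum : Continuous binaryGapSum := by
  refine continuous_tsum (fun n => ?_) (summable_geometric_two.mul_left (1 / 2)) fun n f => ?_
  · exact (continuous_of_discreteTopology (f := fun k : ℕ => (1 / 2 : ℝ) ^ k)).comp
      (continuous_finsetSum _ fun i _ => by fun_prop)
  · rw [Real.norm_of_nonneg (by positivity)]
    exact binaryGapSum_term_le f n

theorem binaryGapSum_pos (f : ℕ → ℕ) : 0 < binaryGapSum f :=
  (summable_binaryGapSum f).tsum_pos (fun _ => by positivity) 0 (by positivity)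

theorem binaryGapSum_le_one (f : ℕ → ℕ) : binaryGapSum f ≤ 1 := by
  calc binaryGapSum f ≤ ∑' n, 1 / 2 * (1 / 2 : ℝ) ^ n :=
        (summable_binaryGapSum f).tsum_le_tsum (binaryGapSum_term_le f)
          (summable_geometric_two.mul_left _)
    _ = 1 := by rw [tsum_mul_left, tsum_geometric_two]; norm_num

theorem binaryGapSum_eq (f : ℕ → ℕ) :
    binaryGapSum f = (1 / 2) ^ (f 0 + 1) * (1 + binaryGapSum fun n => f (n + 1)) := by
  rw [binaryGapSum, (summable_binaryGapSum f).tsum_eq_zero_add, mul_add, mul_one, binaryGapSum,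
    ← tsum_mul_left]
  refine congrArg₂ (· + ·) (by simp) (tsum_congr fun n => ?_)
  rw [Finset.sum_range_succ' _ (n + 1), pow_add, mul_comm]

/-- Since `1 + x` lies in `(1, 2]`, the exponent is read off from the dyadic interval `(2⁻⁽ᵐ⁺¹⁾,
2⁻ᵐ]` containing the product. -/
theorem pow_half_mul_inj {m n : ℕ} {x y : ℝ} (hx : x ∈ Set.Ioc (0 : ℝ) 1)
    (hy : y ∈ Set.Ioc (0 : ℝ) 1) (h : (1 / 2) ^ (m + 1) * (1 + x) = (1 / 2) ^ (n + 1) * (1 + y)) :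
    m = n ∧ x = y := by
  have key : ∀ {m n : ℕ} {x y : ℝ}, x ∈ Set.Ioc (0 : ℝ) 1 → y ∈ Set.Ioc (0 : ℝ) 1 →
      (1 / 2) ^ (m + 1) * (1 + x) = (1 / 2) ^ (n + 1) * (1 + y) → n ≤ m := by
    intro m n x y hx hy h
    by_contra! hlt
    have h1 : (1 / 2 : ℝ) ^ (n + 1) ≤ (1 / 2) ^ (m + 1) * (1 / 2) := by
      rw [← pow_succ]
      exact pow_le_pow_of_le_one (by norm_num) (by norm_num) (by omega)
    have h2 : (0 : ℝ) < (1 / 2) ^ (m + 1) := by positivity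
    nlinarith [hx.1, hy.2, mul_le_mul_of_nonneg_right h1 (by linarith [hy.1] : 0 ≤ 1 + y),
      mul_pos h2 hx.1]
  obtain rfl := le_antisymm (key hy hx h.symm) (key hx hy h)
  have h2 : (0 : ℝ) < (1 / 2) ^ (m + 1) := by positivity
  exact ⟨rfl, add_left_cancel (mul_left_cancel₀ h2.ne' h)⟩

theorem binaryGapSum_mem_Ioc (f : ℕ → ℕ) : binaryGapSum f ∈ Set.Ioc (0 : ℝ) 1 :=
  ⟨binaryGapSum_pos f, binaryGapSum_le_one f⟩

theorem injective_binaryGapSum : Function.Injective binaryGapSum := by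
  have key : ∀ n (f g : ℕ → ℕ), binaryGapSum f = binaryGapSum g → f n = g n := by
    intro n
    induction n with
    | zero =>
      intro f g h
      rw [binaryGapSum_eq f, binaryGapSum_eq g] at h
      exact (pow_half_mul_inj (binaryGapSum_mem_Ioc _) (binaryGapSum_mem_Ioc _) h).1
    | succ n ih =>
      intro f g h
      rw [binaryGapSum_eq f, binaryGapSum_eq g] at h
      exact ih _ _ (pow_half_mul_inj (binaryGapSum_mem_Ioc _) (binaryGapSum_mem_Ioc _) h).2
  exact fun f g h => funext fun n => key n f g h

theorem exists_eq_pow_half_mul {x : ℝ} (hx : x ∈ Set.Ioc (0 : ℝ) 1) :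
    ∃ n : ℕ, ∃ y ∈ Set.Ioc (0 : ℝ) 1, x = (1 / 2) ^ (n + 1) * (1 + y) := by
  obtain ⟨n, hn, hn'⟩ := exists_nat_pow_near_of_lt_one hx.1 hx.2
    (by norm_num : (0 : ℝ) < 1 / 2) (by norm_num)
  refine ⟨n, x * 2 ^ (n + 1) - 1, ⟨?_, ?_⟩, ?_⟩
  · rw [one_div, inv_pow, inv_lt_iff_one_lt_mul₀ (by positivity)] at hn
    linarith
  · rw [one_div, inv_pow, le_inv_comm₀ hx.1 (by positivity), ← one_div,
      le_div_iff₀ hx.1] at hn'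
    rw [pow_succ]
    linarith
  · rw [one_div, inv_pow]
    field_simp
    ring

theorem surjOn_binaryGapSum : Set.SurjOn binaryGapSum Set.univ (Set.Ioc 0 1) := by
  have hdigit := fun (x : ℝ) (hx : x ∈ Set.Ioc (0 : ℝ) 1) => exists_eq_pow_half_mul hx
  choose! d t ht hdt using hdigit
  intro x hx
  have hmem : ∀ n, t^[n] x ∈ Set.Ioc (0 : ℝ) 1 := by
    intro n
    induction n with
    | zero => exact hx
    | succ n ih => rw [Function.iterate_succ_apply']; exact ht _ ih
  -- Peeling off one gap at least halves the error, at the cost of passing to the next tail; hence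
  -- the bound for all `n` at once.
  have hdist : ∀ k n, |t^[n] x - binaryGapSum fun i => d (t^[n + i] x)| ≤ (1 / 2 : ℝ) ^ k := by
    intro k
    induction k with
    | zero =>
      intro n
      have h1 := hmem n
      have h2 := binaryGapSum_mem_Ioc fun i => d (t^[n + i] x)
      rw [abs_le, pow_zero]
      constructor <;> linarith [h1.1, h1.2, h2.1, h2.2]
    | succ k ih =>
      intro n
      have h := ih (n + 1)
      have e1 : t^[n] x = (1 / 2) ^ (d (t^[n] x) + 1) * (1 + t^[n + 1] x) := by
        rw [Function.iterate_succ_apply']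
        exact hdt _ (hmem n)
      have e2 : (fun i => d (t^[n + (i + 1)] x)) = fun i => d (t^[n + 1 + i] x) := by
        funext i
        rw [add_comm i 1, add_assoc]
      rw [binaryGapSum_eq, e2, add_zero]
      have h3 : (1 / 2 : ℝ) ^ d (t^[n] x) ≤ 1 := pow_le_one₀ (by norm_num) (by norm_num)
      calc _ = |(1 / 2) ^ (d (t^[n] x) + 1) * (1 + t^[n + 1] x) - (1 / 2) ^ (d (t^[n] x) + 1) *
              (1 + binaryGapSum fun i => d (t^[n + 1 + i] x))| := by rw [← e1]
        _ = 1 / 2 * (1 / 2) ^ d (t^[n] x) *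
              |t^[n + 1] x - binaryGapSum fun i => d (t^[n + 1 + i] x)| := by
            rw [← mul_sub, add_sub_add_left_eq_sub, abs_mul, abs_of_nonneg (by positivity), pow_succ']
        _ ≤ 1 / 2 * 1 * (1 / 2 : ℝ) ^ k := by gcongr
        _ = _ := by ring
  refine ⟨fun i => d (t^[i] x), Set.mem_univ _, ?_⟩
  by_contra hne
  have hpos : 0 < |x - binaryGapSum fun i => d (t^[i] x)| :=
    abs_pos.2 (sub_ne_zero.2 (Ne.symm hne))
  obtain ⟨k, hk⟩ := exists_pow_lt_of_lt_one hpos (by norm_num : (1 / 2 : ℝ) < 1)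
  have := hdist k 0
  simp only [zero_add, Function.iterate_zero, id] at this
  exact absurd this (not_le.2 hk)

theorem bijective_int_add_binaryGapSum :
    Function.Bijective fun p : ℤ × (ℕ → ℕ) => (p.1 : ℝ) + binaryGapSum p.2 := by
  constructor
  · rintro ⟨m, f⟩ ⟨n, g⟩ h
    dsimp only at h
    have hf := binaryGapSum_mem_Ioc f
    have hg := binaryGapSum_mem_Ioc g
    have h1 : (m : ℝ) < n + 1 := by linarith [hf.1, hg.2]
    have h2 : (n : ℝ) < m + 1 := by linarith [hg.1, hf.2]
    norm_cast at h1 h2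
    obtain rfl : m = n := by omega
    rw [injective_binaryGapSum (add_left_cancel h)]
  · intro x
    obtain ⟨f, -, hf⟩ := surjOn_binaryGapSum
      -- The ceiling, not the floor, since the unit interval is open on the left.
      (show x - (⌈x⌉ - 1 : ℤ) ∈ Set.Ioc (0 : ℝ) 1 by
        push_cast
        constructor <;> linarith [Int.le_ceil x, Int.ceil_lt_add_one x])
    exact ⟨(⌈x⌉ - 1, f), by dsimp only; rw [hf]; ring⟩

/-! ### The minimum is attained -/

theorem sierpinskiCardinal_mem_closedPartitionSpectrum :
    sierpinskiCardinal ∈ closedPartitionSpectrum := by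
  obtain ⟨P, hP, hK, hcard⟩ := isLeast_sierpinskiCardinal.1
  have hinf := aleph0_le_sierpinskiCardinal
  have hne : ∀ E ∈ P, E.Nonempty := fun E hE => Set.nonempty_iff_ne_empty.2 fun h => hP.1 (h ▸ hE)
  obtain ⟨hinj, hsurj⟩ := bijective_int_add_binaryGapSum
  let piece : ℤ × P → Set ℝ := fun q => (fun f => (q.1 : ℝ) + binaryGapSum f) '' q.2.1
  have hpiece : ∀ q r : ℤ × P, ∀ x, x ∈ piece q → x ∈ piece r → q = r := by
    rintro ⟨m, K, hKP⟩ ⟨n, L, hLP⟩ _ ⟨f, hf, rfl⟩ ⟨g, hg, h⟩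
    obtain ⟨rfl, rfl⟩ := Prod.mk.inj (hinj (a₁ := (n, g)) (a₂ := (m, f)) h)
    obtain rfl := (hP.2 g).unique ⟨hKP, hf⟩ ⟨hLP, hg⟩
    rfl
  have hpne : ∀ q, (piece q).Nonempty := fun q => (hne q.2.1 q.2.2).image _
  have hpinj : Function.Injective piece := by
    intro q r h
    obtain ⟨x, hx⟩ := hpne q
    exact hpiece q r x hx (h ▸ hx)
  have hsize : #(Set.range piece) = sierpinskiCardinal := by
    rw [mk_range_eq _ hpinj, mk_prod, hcard, lift_id, lift_id, mk_int, aleph0_mul_eq hinf]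
  refine ⟨Set.range piece, ⟨?_, fun x => ?_⟩, ?_, ?_, hsize⟩
  · rintro ⟨q, hq⟩
    exact (hpne q).ne_empty hq
  · obtain ⟨⟨m, f⟩, rfl⟩ := hsurj x
    obtain ⟨K, ⟨hKP, hfK⟩, -⟩ := hP.2 f
    have hmem : (m : ℝ) + binaryGapSum f ∈ piece (m, ⟨K, hKP⟩) := ⟨f, hfK, rfl⟩
    refine ⟨_, ⟨⟨_, rfl⟩, hmem⟩, ?_⟩
    rintro _ ⟨⟨q, rfl⟩, hq⟩
    rw [hpiece _ _ _ hq hmem]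
  · rintro _ ⟨q, rfl⟩
    exact ((hK q.2.1 q.2.2).image (continuous_const.add continuous_binaryGapSum)).isClosed
  · rw [hsize]
    exact (ofNat_lt_aleph0 (n := 2)).le.trans hinf

theorem corollary2p6 :
    IsLeast closedPartitionSpectrum sierpinskiCardinal ∧
      dominatingNumber ≤ sierpinskiCardinal := by
  refine ⟨⟨sierpinskiCardinal_mem_closedPartitionSpectrum, ?_⟩,
    dominatingNumber_le_sierpinskiCardinal⟩
  rintro _ ⟨P, hP, hcl, h2, rfl⟩
  exact sierpinskiCardinal_le_of_isClosed_partition hP hcl h2
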